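/- Let $q=2^r$ with $r\ge 1$, let $\mathbb F_q$ be the field with $q$ elements, $\operatorname{tr}(x)=x+x^2+\cdots+x^{2^{r-1}}$ the trace $\mathbb F_q\to\mathbb F_2$, and $\lambda(x)=(-1)^{\operatorname{tr}(x)}$. For $a\in\mathbb F_q^*$ let $K(a)=\sum_{\alpha\in\mathbb F_q^*}\lambda(\alpha+a\alpha^{-1})$ be the Kloosterman sum, and for $h\ge 0$ let $MK^h=\sum_{a\in\mathbb F_q^*}K(a)^h$. For $n\ge 1$ let $P^+(2n,q)$ be the group of the $2n\times 2n$ matrices $$\begin{bmatrix}A&0\\0&{}^tA^{-1}\end{bmatrix}\begin{bmatrix}1_n&B\\0&1_n\end{bmatrix},\qquad A\in GL(n,q),\ B\text{ an alternating } n\times n \text{ matrix over } \mathbb F_q,$$ and for $0\le s\le n$ let $\sigma_s^+$ be the permutation matrix that exchanges the $i$-th and $(n+i)$-th standard basis vectors for $1\le i\le s$ and fixes the other ones. Put $DC_1^+(2,q)=P^+(4,q)\,\sigma_1^+\,P^+(4,q)$ and $DC_1^-(1,q)=P^+(2,q)\,\sigma_0^+\,P^+(2,q)$. For a set $S=\{g_1,\dots,g_N\}$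 of $N$ square matrices over $\mathbb F_q$, let $C(S)=\{u\in\mathbb F_2^N : \sum_{i=1}^N u_i\operatorname{Tr}(g_i)=0\}$, where $\operatorname{Tr}$ is the matrix trace; this is a binary linear code of length $N$. Let $C_{1,j}^+(2,q)$ and $C_{1,j}^-(1,q)$ be the numbers of codewords of Hamming weight $j$ in $C(DC_1^+(2,q))$ and $C(DC_1^-(1,q))$, respectively. Let $S(h,t)=\frac1{t!}\sum_{j=0}^t(-1)^{t-j}\binom tj j^h$ be the Stirling number of the second kind, and let $\binom ba=0$ if $a>b$ or $a<0$. Below, the conditions $\operatorname{tr}(\beta^{-1})=0$ and $\operatorname{tr}(\beta^{-1})=1$ are on $\beta\in\mathbb F_q^*$. (a) For all $q$, the code $C(DC_1^+(2,q))$ has length $N=|DC_1^+(2,q)|=q^2(q^2-1)^2$; for $h=1,2,\dots$, $$MK^h=\sum_{l=0}^{h-1}(-1)^{h+l+1}\binom hl(q^2-1)^{h-l}MK^l+q^{1-2h}(q^2-1)^{-h}\sum_{j=0}^{\min\{N,h\}}(-1)^{h+j}C_{1,j}^+(2,q)\sum_{t=j}^h t!\,S(h,t)\,2^{h-t}\binom{N-j}{N-t};$$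 and, for $0\le j\le N$, $$C_{1,j}^+(2,q)=\sum\binom{q^3(q^2-1)}{\nu_0}\prod_{\operatorname{tr}(\beta^{-1})=0}\binom{q^2(q-1)(q+1)^2}{\nu_\beta}\prod_{\operatorname{tr}(\beta^{-1})=1}\binom{q^2(q+1)(q-1)^2}{\nu_\beta},$$ where the sum is over all families $\{\nu_\beta\}_{\beta\in\mathbb F_q}$ of nonnegative integers with $\sum_{\beta\in\mathbb F_q}\nu_\beta=j$ and $\sum_{\beta\in\mathbb F_q}\nu_\beta\beta=0$ in $\mathbb F_q$. (b) One has $DC_1^-(1,q)=P^+(2,q)$, and the code $C(DC_1^-(1,q))$ has length $|DC_1^-(1,q)|=q-1$. Let $q\ge 8$. For $h=1,2,\dots$, $$MK^h=\sum_{l=0}^{h-1}(-1)^{h+l+1}\binom hl(q-1)^{h-l}MK^l+q\sum_{j=0}^{\min\{q-1,h\}}(-1)^{h+j}C_{1,j}^-(1,q)\sum_{t=j}^h t!\,S(h,t)\,2^{h-t}\binom{q-1-j}{q-1-t};$$ and, for $0\le j\le q-1$, $$C_{1,j}^-(1,q)=\sum\binom1{\nu_0}\prod_{\operatorname{tr}(\beta^{-1})=0}\binom2{\nu_\beta},$$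 where the sum is over all families of nonnegative integers $\{\nu_0\}\cup\{\nu_\beta\}_{\operatorname{tr}(\beta^{-1})=0}$ with $\nu_0+\sum_{\operatorname{tr}(\beta^{-1})=0}\nu_\beta=j$ and $\sum_{\operatorname{tr}(\beta^{-1})=0}\nu_\beta\beta=0$ in $\mathbb F_q$. -/

import Mathlib

open Finset

namespace KloostermanCode

/-! ### Characters and Kloosterman sums

Throughout, `F` is a finite field of characteristic two, that is, a finite field which is an
algebra over `ZMod 2`. -/

section Sums

variable {F : Type*} [Field F] [Fintype F] [Algebra (ZMod 2) F]

/-- The absolute trace `tr(x) = x + x² + ⋯ + x^(2^(r-1))` of the field with `2 ^ r` elements. -/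
noncomputable def tr (x : F) : ZMod 2 :=
  Algebra.trace (ZMod 2) F x

/-- The canonical additive character `x ↦ (-1) ^ tr(x)`. -/
noncomputable def canonicalChar (x : F) : ℤ :=
  (-1) ^ (tr x).val

variable [DecidableEq F]

/-- The Kloosterman sum `K(λ; a) = ∑_{α ≠ 0} λ(α + a α⁻¹)`. -/
noncomputable def kloosterman (a : Fˣ) : ℤ :=
  ∑ α : Fˣ, canonicalChar ((α : F) + (a : F) * (α : F)⁻¹)

variable (F) in
/-- The `h`-th power moment `∑_{a ≠ 0} K(λ; a) ^ h`. -/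
noncomputable def moment (h : ℕ) : ℤ :=
  ∑ a : Fˣ, kloosterman a ^ h

variable (F) in
/-- The nonzero `β` with `tr(β⁻¹) = c`. -/
noncomputable def trInv (c : ZMod 2) : Finset F :=
  univ.filter fun β => β ≠ 0 ∧ tr β⁻¹ = c

end Sums

/-! ### Double cosets in the orthogonal group of the form `∑ xᵢ xₙ₊ᵢ` -/

section Cosets

variable (F : Type*) [Field F]

/-- The parabolic subgroup `P⁺(2n, q)`, as a set of matrices: all products
`[A, 0; 0, ᵗA⁻¹] [1, B; 0, 1]` with `A` invertible and `B` alternating. -/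
def parabolic (n : ℕ) : Set (Matrix (Fin n ⊕ Fin n) (Fin n ⊕ Fin n) F) :=
  {w | ∃ (A : GL (Fin n) F) (B : Matrix (Fin n) (Fin n) F),
    (∀ i, B i i = 0) ∧ (∀ i j, B i j = -B j i) ∧
    w = Matrix.fromBlocks A.val 0 0 A⁻¹.val.transpose * Matrix.fromBlocks 1 B 0 1}

/-- The matrix `σ_r⁺`, which exchanges the basis vectors `i` and `n + i` for the first `r`
indices `i` and fixes all the others. -/
def sigma (n r : ℕ) : Matrix (Fin n ⊕ Fin n) (Fin n ⊕ Fin n) F :=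
  Matrix.fromBlocks
    (Matrix.diagonal fun i => if i.val < r then 0 else 1)
    (Matrix.diagonal fun i => if i.val < r then 1 else 0)
    (Matrix.diagonal fun i => if i.val < r then 1 else 0)
    (Matrix.diagonal fun i => if i.val < r then 0 else 1)

open Classical in
/-- The double coset `P⁺ σ_{n-1}⁺ P⁺`. It is written `DC₁⁺(n, q)` for even `n` and `DC₁⁻(n, q)`
for odd `n`. -/
noncomputable def dcOne [Fintype F] (n : ℕ) :
    Finset (Matrix (Fin n ⊕ Fin n) (Fin n ⊕ Fin n) F) :=
  univ.filter fun w => ∃ p ∈ parabolic F n, ∃ p' ∈ parabolic F n, w = p * sigma F n (n - 1) * p'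

end Cosets

/-! ### Codes -/

section Codes

variable {F : Type*} [Field F] [Algebra (ZMod 2) F] {m : Type*} [Fintype m]

/-- The binary code `C(S)` of a finite set `S` of matrices: the coordinates are indexed by the
elements of `S`, and `u` is a codeword when `∑_{g ∈ S} u_g Tr(g) = 0` in `F`. -/
def code (S : Finset (Matrix m m F)) : Submodule (ZMod 2) (S → ZMod 2) where
  carrier := {u | ∑ g : S, algebraMap (ZMod 2) F (u g) * Matrix.trace g.val = 0}
  add_mem' {u v} hu hv := by
    change ∑ g : S, algebraMap (ZMod 2) F (u g + v g) * Matrix.trace g.val = 0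
    simp_rw [map_add, add_mul]
    rw [Finset.sum_add_distrib, show _ = _ from hu, show _ = _ from hv, add_zero]
  zero_mem' := by
    change ∑ g : S, algebraMap (ZMod 2) F 0 * Matrix.trace g.val = 0
    simp
  smul_mem' c u hu := by
    change ∑ g : S, algebraMap (ZMod 2) F (c * u g) * Matrix.trace g.val = 0
    simp_rw [map_mul, mul_assoc]
    rw [← Finset.mul_sum, show _ = _ from hu, mul_zero]

/-- The number of codewords of Hamming weight `j` in the code `C(S)`. -/
noncomputable def weightCount (S : Finset (Matrix m m F)) (j : ℕ) : ℕ :=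
  Set.ncard {u : S → ZMod 2 | u ∈ code S ∧ hammingNorm u = j}

end Codes

/-! ### Combinatorial numbers -/

/-- The binomial coefficient of `b` over `a`, which is `0` for `a < 0` and for `a > b`. -/
def binom (b : ℕ) (a : ℤ) : ℕ :=
  if a < 0 then 0 else b.choose a.toNat

/-- The Stirling number of the second kind
`S(h, t) = (1 / t!) ∑_{j=0}^{t} (-1)^(t-j) (t choose j) j^h`. -/
def stirling (h t : ℕ) : ℚ :=
  1 / (t.factorial : ℚ) *
    ∑ j ∈ range (t + 1), (-1 : ℚ) ^ (t - j) * (t.choose j : ℚ) * (j : ℚ) ^ h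

end KloostermanCode

open KloostermanCode

set_option linter.unusedSectionVars false

namespace KloostermanCode

/-! ### Additive characters, the quadratic `x ^ 2 + β * x + 1`, and Kloosterman sums. -/

section Characters

variable {F : Type*} [Field F] [Fintype F] [Algebra (ZMod 2) F]

/-! Let `R β` be the number of roots of `x ^ 2 + β * x + 1`, that is, of units `α` with `α + α⁻¹ =
β`. It is 1 for `β = 0`, and otherwise 2 or 0 according as `tr β⁻¹` is 0 or 1 (`card_quadRoots`).
Substituting `bα` for `α` gives `∑ R β * λ(b β) = K(b ^ 2)`, and squaring permutes the units, so the
squares do not affect power moments.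

In both cosets the number of elements of trace `β` is `c * (d + R β)`. The constant `d` is invisible
to nontrivial characters, so `∑ λ(b Tr g) = c * K(b ^ 2)`. If the coset has `c * M` elements, the
word `(tr (b Tr g))` therefore has weight `w` with `2w = c * (M - K(b ^ 2))`. The sum of `w ^ h`
over `b` is then, on one side, a binomial expression in the moments of `K` and, on the other, an
expression in the weight distribution of the code, by a Pless power moment identity
(`two_pow_mul_sum_dualWeight_pow`). That identity is proved by character orthogonality with all
field elements `a` as index, so `a ↦ (tr (a Tr g))` need not be injective. Equating both sides and
solving for the top moment is `moment_recursion`. The weight formulas follow by choosing how many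
coordinates to take from each trace fibre.

For `n = 1` the coset is the torus of the `diag(α, α⁻¹)`, with `c = 1` and `d = 0`. For `n = 2`, the
form `x₁x₃ + x₂x₄` is the determinant on `2 × 2` matrices, and `σ₁⁺` is `X ↦ adj X`. The coset
consists of the maps `X ↦ A (adj X) B` with `det A = det B = 1`, each given by one pair, with trace
`tr(A B⁻¹)` (`dcOne_two`). Counting reduces to `SL(2, q)` by trace, with `c = q²(q² - 1)` and `d = q
- 1`. -/

theorem charP_two : CharP F 2 :=
  charP_of_injective_algebraMap (algebraMap (ZMod 2) F).injective 2

theorem tr_add (x y : F) : tr (x + y) = tr x + tr y := map_add _ _ _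

theorem tr_zero : tr (0 : F) = 0 := map_zero _

theorem tr_sq (x : F) : tr (x ^ 2) = tr x := by
  have : CharP F 2 := charP_two
  have h := Algebra.trace_eq_of_algEquiv (FiniteField.frobeniusAlgEquiv (ZMod 2) F 2) x
  simpa [tr, ZMod.card] using h

theorem exists_tr_eq_one : ∃ x : F, tr x = 1 :=
  Algebra.trace_surjective (ZMod 2) F 1

theorem canonicalChar_add (x y : F) :
    canonicalChar (x + y) = canonicalChar x * canonicalChar y := by
  unfold canonicalChar
  rw [tr_add]
  generalize tr x = a
  generalize tr y = b
  revert a b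
  decide

theorem canonicalChar_zero : canonicalChar (0 : F) = 1 := by
  simp [canonicalChar, tr_zero]

theorem canonicalChar_sq (x : F) : canonicalChar (x ^ 2) = canonicalChar x := by
  rw [canonicalChar, tr_sq, canonicalChar]

theorem canonicalChar_sum {ι : Type*} (s : Finset ι) (f : ι → F) :
    canonicalChar (∑ i ∈ s, f i) = ∏ i ∈ s, canonicalChar (f i) := by
  classical
  induction s using Finset.induction_on with
  | empty => simp [canonicalChar_zero]
  | insert i s hi ih => rw [sum_insert hi, prod_insert hi, canonicalChar_add, ih]

theorem canonicalChar_eq_one_sub (x : F) :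
    canonicalChar x = 1 - 2 * (if tr x = 1 then 1 else 0) := by
  unfold canonicalChar
  generalize tr x = a
  revert a
  decide

theorem sum_canonicalChar : ∑ a : F, canonicalChar a = 0 := by
  obtain ⟨x, hx⟩ := exists_tr_eq_one (F := F)
  have h : ∑ a : F, canonicalChar (x + a) = ∑ a : F, canonicalChar a :=
    Equiv.sum_comp (Equiv.addLeft x) (fun a => canonicalChar a)
  simp_rw [canonicalChar_add, ← mul_sum] at h
  rw [canonicalChar_eq_one_sub x, if_pos hx] at h
  linarith

variable [DecidableEq F]

theorem sum_canonicalChar_mul (y : F) :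
    ∑ a : F, canonicalChar (a * y) = if y = 0 then (Fintype.card F : ℤ) else 0 := by
  split_ifs with hy
  · simp [hy, canonicalChar_zero]
  · rw [← sum_canonicalChar (F := F)]
    exact Equiv.sum_comp (Equiv.mulRight₀ y hy) (fun a => canonicalChar a)

theorem sum_canonicalChar_mul_sq (y : F) :
    ∑ a : F, canonicalChar (y * a ^ 2) = if y = 0 then (Fintype.card F : ℤ) else 0 := by
  have : CharP F 2 := charP_two
  rw [← sum_canonicalChar_mul]
  have hb : Function.Bijective fun a : F => a ^ 2 :=
    Finite.injective_iff_bijective.mp fun a b hab => frobenius_inj F 2 hab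
  rw [← hb.sum_comp fun a => canonicalChar (a * y)]
  exact sum_congr rfl fun a _ => by rw [mul_comm]

/-- The roots of `x ^ 2 + β * x + 1`. -/
def quadRoots (β : F) : Finset F := univ.filter fun a => a ^ 2 + β * a + 1 = 0

/-- Detect roots by summing `λ(b (a ^ 2 + β a + 1))` over `a` and `b`. Since `λ(x ^ 2) = λ(x)`, the
linear term `b β a` can be replaced by its square, so the sum over `a` survives only for `b = 0` and
`b = β⁻²`. -/
theorem card_quadRoots (β : F) :
    ((quadRoots β).card : ℤ) = 1 + if β = 0 then 0 else canonicalChar β⁻¹ := by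
  have : CharP F 2 := charP_two
  have hq : (Fintype.card F : ℤ) ≠ 0 := by exact_mod_cast Fintype.card_ne_zero
  have h1 : ∑ a : F, ∑ b : F, canonicalChar (b * (a ^ 2 + β * a + 1)) =
      Fintype.card F * (quadRoots β).card := by
    simp_rw [sum_canonicalChar_mul]
    rw [← sum_filter, sum_const, quadRoots, nsmul_eq_mul, mul_comm]
  have h2 : ∀ b : F, ∑ a : F, canonicalChar (b * (a ^ 2 + β * a + 1)) =
      if b + b ^ 2 * β ^ 2 = 0 then Fintype.card F * canonicalChar b else 0 := by
    intro b
    have : ∀ a : F, canonicalChar (b * (a ^ 2 + β * a + 1)) =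
        canonicalChar b * canonicalChar ((b + b ^ 2 * β ^ 2) * a ^ 2) := by
      intro a
      rw [show b * (a ^ 2 + β * a + 1) = b + (b * a ^ 2 + b * β * a) by ring,
        canonicalChar_add, canonicalChar_add, ← canonicalChar_sq (b * β * a),
        ← canonicalChar_add]
      congr 2
      ring
    simp_rw [this, ← mul_sum, sum_canonicalChar_mul_sq]
    split_ifs <;> ring
  rw [sum_comm] at h1
  simp_rw [h2] at h1
  rw [← sum_filter, ← mul_sum] at h1
  rw [← mul_left_cancel₀ hq h1]
  split_ifs with hβ
  · have : (univ.filter fun b : F => b + b ^ 2 * β ^ 2 = 0) = {0} := by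
      ext b; simp [hβ]
    rw [this, sum_singleton, canonicalChar_zero, add_zero]
  · have : (univ.filter fun b : F => b + b ^ 2 * β ^ 2 = 0) = {0, (β⁻¹) ^ 2} := by
      ext b
      simp only [mem_filter, mem_univ, true_and, mem_insert, mem_singleton]
      rw [show b + b ^ 2 * β ^ 2 = b * (1 + b * β ^ 2) by ring, mul_eq_zero]
      refine or_congr Iff.rfl ?_
      rw [CharTwo.add_eq_zero, inv_pow, eq_comm, mul_eq_one_iff_eq_inv₀ (pow_ne_zero 2 hβ)]
    rw [this, sum_pair (Ne.symm (pow_ne_zero 2 (inv_ne_zero hβ))), canonicalChar_zero,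
      canonicalChar_sq]

theorem card_quadRoots_zero : (quadRoots (0 : F)).card = 1 := by
  have := card_quadRoots (0 : F)
  rw [if_pos rfl] at this
  exact_mod_cast this

theorem card_quadRoots_of_mem_trInv_zero {β : F} (hβ : β ∈ trInv F 0) :
    (quadRoots β).card = 2 := by
  obtain ⟨h0, h1⟩ := (mem_filter.mp hβ).2
  have := card_quadRoots β
  rw [if_neg h0, canonicalChar, h1] at this
  norm_num at this
  exact_mod_cast this

theorem card_quadRoots_of_mem_trInv_one {β : F} (hβ : β ∈ trInv F 1) :
    (quadRoots β).card = 0 := by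
  obtain ⟨h0, h1⟩ := (mem_filter.mp hβ).2
  have := card_quadRoots β
  rw [if_neg h0, canonicalChar, h1, ZMod.val_one] at this
  norm_num at this
  simp [this]

theorem insert_zero_trInv_union : insert 0 (trInv F 0 ∪ trInv F 1) = univ := by
  ext β
  have : ∀ c : ZMod 2, c = 0 ∨ c = 1 := by decide
  have := this (tr β⁻¹)
  simp only [trInv, mem_insert, mem_union, mem_filter, mem_univ, true_and, iff_true]
  tauto

theorem zero_notMem_trInv (c : ZMod 2) : (0 : F) ∉ trInv F c := by
  simp [trInv]

theorem disjoint_trInv : Disjoint (trInv F 0) (trInv F 1) := by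
  rw [disjoint_left]
  intro β h0 h1
  have h := (mem_filter.mp h0).2.2
  rw [(mem_filter.mp h1).2.2] at h
  exact one_ne_zero h

theorem prod_univ_eq_trInv {M : Type*} [CommMonoid M] (g : F → M) :
    ∏ β, g β = g 0 * (∏ β ∈ trInv F 0, g β) * ∏ β ∈ trInv F 1, g β := by
  rw [← insert_zero_trInv_union, prod_insert, prod_union disjoint_trInv, mul_assoc]
  simp [zero_notMem_trInv]

theorem add_inv_eq_iff [CharP F 2] (α : Fˣ) (β : F) :
    (α : F) + (α : F)⁻¹ = β ↔ (α : F) ^ 2 + β * α + 1 = 0 := by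
  have hα : (α : F) ≠ 0 := α.ne_zero
  rw [← CharTwo.add_eq_zero, ← mul_left_inj' hα, zero_mul]
  have : ((α : F) + (α : F)⁻¹ + β) * α = (α : F) ^ 2 + β * α + 1 := by
    field_simp
    ring
  rw [this]

theorem card_units_add_inv (β : F) :
    (univ.filter fun α : Fˣ => (α : F) + (α : F)⁻¹ = β).card = (quadRoots β).card := by
  have : CharP F 2 := charP_two
  refine card_bij (fun α _ => (α : F)) ?_ (fun a _ b _ h => Units.ext h) ?_
  · intro α hα
    simpa [quadRoots, add_inv_eq_iff] using hα
  · intro a ha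
    have ha' : a ^ 2 + β * a + 1 = 0 := by simpa [quadRoots] using ha
    have h0 : a ≠ 0 := by
      rintro rfl
      simp at ha'
    exact ⟨Units.mk0 a h0, mem_filter.mpr ⟨mem_univ _,
      (add_inv_eq_iff (Units.mk0 a h0) β).mpr ha'⟩, rfl⟩

theorem sum_card_quadRoots_mul (g : F → ℤ) :
    ∑ β, ((quadRoots β).card : ℤ) * g β = ∑ α : Fˣ, g ((α : F) + (α : F)⁻¹) := by
  rw [← sum_fiberwise univ (fun α : Fˣ => (α : F) + (α : F)⁻¹)]
  refine sum_congr rfl fun β _ => ?_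
  rw [← card_units_add_inv, ← nsmul_eq_mul, ← sum_const]
  exact sum_congr rfl fun α hα => by rw [(mem_filter.mp hα).2]

/-- The left side is the sum of `λ(b α + b α⁻¹)` over units `α`; with `α' = b α` the second term
becomes `b ^ 2 α'⁻¹`. -/
theorem sum_card_quadRoots_mul_canonicalChar (b : Fˣ) :
    ∑ β, ((quadRoots β).card : ℤ) * canonicalChar ((b : F) * β) = kloosterman (b ^ 2) := by
  rw [sum_card_quadRoots_mul fun β => canonicalChar ((b : F) * β), kloosterman]
  rw [← Equiv.sum_comp (Equiv.mulLeft b) fun α : Fˣ =>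
    canonicalChar ((α : F) + ((b ^ 2 : Fˣ) : F) * (α : F)⁻¹)]
  refine sum_congr rfl fun α _ => ?_
  have hb : (b : F) ≠ 0 := b.ne_zero
  have hα : (α : F) ≠ 0 := α.ne_zero
  congr 1
  simp only [Equiv.coe_mulLeft, Units.val_mul, Units.val_pow_eq_pow_val]
  field_simp

theorem sum_card_quadRoots : ∑ β : F, (quadRoots β).card = Fintype.card F - 1 := by
  have h := sum_card_quadRoots_mul (F := F) fun _ => 1
  simp only [mul_one, sum_const, card_univ, nsmul_eq_mul, Fintype.card_units] at h
  exact_mod_cast h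

theorem sum_kloosterman_sq_pow (h : ℕ) : ∑ b : Fˣ, kloosterman (b ^ 2) ^ h = moment F h := by
  have : CharP F 2 := charP_two
  have hb : Function.Bijective fun a : Fˣ => a ^ 2 := by
    refine Finite.injective_iff_bijective.mp fun a b hab => Units.ext ?_
    exact frobenius_inj F 2 (by simpa [frobenius_def] using congrArg Units.val hab)
  exact hb.sum_comp fun a => kloosterman a ^ h

end Characters

/-! ### Stirling numbers as finite differences. -/

section Stirling

theorem factorial_mul_stirling (h t : ℕ) :
    (t.factorial : ℚ) * stirling h t = (fwdDiff (1 : ℚ))^[t] (fun x => x ^ h) 0 := by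
  have : (t.factorial : ℚ) ≠ 0 := by exact_mod_cast t.factorial_ne_zero
  rw [fwdDiff_iter_eq_sum_shift, stirling, ← mul_assoc, mul_one_div_cancel this, one_mul]
  exact sum_congr rfl fun j _ => by simp

/-- Newton's forward difference formula for `x ^ h` at 0. -/
theorem pow_eq_sum_stirling (h w : ℕ) :
    (w : ℚ) ^ h = ∑ t ∈ range (h + 1), (t.factorial : ℚ) * stirling h t * (w.choose t : ℚ) := by
  have key := shift_eq_sum_fwdDiff_iter (1 : ℚ) (fun x : ℚ => x ^ h) w 0
  simp only [zero_add, nsmul_eq_mul, mul_one] at key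
  rw [key]
  simp_rw [factorial_mul_stirling]
  -- Both ranges extend to a common one: binomials vanish for `t > w`, differences of `x ^ h` for `t
  -- > h`.
  trans ∑ t ∈ range (max w h + 1), (w.choose t : ℚ) * (fwdDiff (1 : ℚ))^[t] (fun x => x ^ h) 0
  · refine sum_subset (range_subset_range.mpr (by omega)) fun t _ ht => ?_
    rw [Nat.choose_eq_zero_of_lt (by simpa using ht), Nat.cast_zero, zero_mul]
  · symm
    simp_rw [mul_comm ((w.choose _ : ℕ) : ℚ)]
    refine sum_subset (range_subset_range.mpr (by omega)) fun t _ ht => ?_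
    rw [fwdDiff_iter_pow_eq_zero_of_lt (by simpa using ht), Pi.zero_apply, zero_mul]

theorem binom_sub {N t j : ℕ} (hj : j ≤ t) (hN : j ≤ N) :
    binom (N - j) ((N : ℤ) - t) = (N - j).choose (t - j) := by
  unfold binom
  split_ifs with h
  · rw [Nat.choose_eq_zero_of_lt (by omega)]
  · rw [show ((N : ℤ) - t).toNat = N - j - (t - j) by omega, Nat.choose_symm (by omega)]

end Stirling

/-! ### Power moments of the dual weights and the recursion. -/

section PowerMoments

variable {F : Type*} [Field F] [Fintype F] [Algebra (ZMod 2) F] [DecidableEq F]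
variable {ι : Type*} [DecidableEq ι]

/-- The number of `j`-element subsets of `S` over which `f` sums to zero. -/
def zeroSumCount (S : Finset ι) (f : ι → F) (j : ℕ) : ℕ :=
  ((S.powersetCard j).filter fun T => ∑ i ∈ T, f i = 0).card

/-- The weight of the word `(tr (a * f i))`, for `i ∈ S`. -/
noncomputable def dualWeight (S : Finset ι) (f : ι → F) (a : F) : ℕ :=
  (S.filter fun i => tr (a * f i) = 1).card

theorem zeroSumCount_eq_zero {S : Finset ι} (f : ι → F) {j : ℕ} (hj : S.card < j) :
    zeroSumCount S f j = 0 := by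
  rw [zeroSumCount, powersetCard_eq_empty.mpr hj, filter_empty, card_empty]

theorem two_mul_dualWeight (S : Finset ι) (f : ι → F) (a : F) :
    2 * (dualWeight S f a : ℤ) = S.card - ∑ i ∈ S, canonicalChar (a * f i) := by
  simp_rw [canonicalChar_eq_one_sub]
  rw [sum_sub_distrib, ← mul_sum, sum_boole, dualWeight]
  simp

/-- The binomial counts the `t`-subsets on which the word is constantly 1. The indicator of one such
subset is `2 ^ (-t)` times a product of factors `1 - λ`, expanded over its subsets `U`. -/
theorem two_pow_mul_choose_dualWeight (S : Finset ι) (f : ι → F) (a : F) (t : ℕ) :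
    2 ^ t * ((dualWeight S f a).choose t : ℤ) =
      ∑ T ∈ S.powersetCard t, ∑ U ∈ T.powerset,
        (-1) ^ U.card * canonicalChar (a * ∑ i ∈ U, f i) := by
  have h1 : (dualWeight S f a).choose t =
      ((S.powersetCard t).filter fun T => ∀ i ∈ T, tr (a * f i) = 1).card := by
    rw [dualWeight, ← card_powersetCard]
    congr 1
    ext T
    simp only [mem_powersetCard, mem_filter, subset_iff]
    exact ⟨fun h => ⟨⟨fun i hi => (h.1 hi).1, h.2⟩, fun i hi => (h.1 hi).2⟩,
      fun h => ⟨fun i hi => ⟨h.1.1 hi, h.2 i hi⟩, h.1.2⟩⟩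
  rw [h1, ← sum_boole, mul_sum]
  refine sum_congr rfl fun T hT => ?_
  have h2 : ∏ i ∈ T, (-canonicalChar (a * f i) + 1) =
      2 ^ t * (if ∀ i ∈ T, tr (a * f i) = 1 then 1 else 0) := by
    simp_rw [canonicalChar_eq_one_sub, neg_sub, sub_add_cancel]
    rw [prod_mul_distrib, prod_const, (mem_powersetCard.mp hT).2, prod_boole]
  rw [← h2, prod_add]
  refine sum_congr rfl fun U _ => ?_
  rw [prod_const_one, mul_one, prod_neg, mul_sum, canonicalChar_sum]

/-- The MacWilliams identities in binomial form. Summation over `a` keeps only the zero-sum sets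
`U`, and a `U` of size `j` lies in `(N - j).choose (t - j)` sets of size `t`. -/
theorem sum_choose_dualWeight (S : Finset ι) (f : ι → F) (t : ℕ) :
    2 ^ t * ∑ a : F, ((dualWeight S f a).choose t : ℤ) =
      Fintype.card F * ∑ j ∈ range (t + 1),
        (-1) ^ j * (zeroSumCount S f j : ℤ) * ((S.card - j).choose (t - j) : ℤ) := by
  simp_rw [mul_sum, two_pow_mul_choose_dualWeight]
  have hchar : ∑ a : F, ∑ T ∈ S.powersetCard t, ∑ U ∈ T.powerset,
        (-1) ^ U.card * canonicalChar (a * ∑ i ∈ U, f i) =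
      ∑ T ∈ S.powersetCard t, ∑ U ∈ T.powerset,
        (-1) ^ U.card * if ∑ i ∈ U, f i = 0 then (Fintype.card F : ℤ) else 0 := by
    rw [sum_comm]
    refine sum_congr rfl fun T _ => ?_
    rw [sum_comm]
    exact sum_congr rfl fun U _ => by rw [← mul_sum, sum_canonicalChar_mul]
  rw [hchar, sum_comm' (t' := S.powerset.filter fun U => U.card ≤ t)
    (s' := fun U => (S.powersetCard t).filter fun T => U ⊆ T)]
  · rw [← sum_fiberwise_of_maps_to (t := range (t + 1)) (g := fun U => U.card)]
    · refine sum_congr rfl fun j hj => ?_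
      have hjt : j ≤ t := by simpa [Nat.lt_succ_iff] using hj
      have hset : ((S.powerset.filter fun U => U.card ≤ t).filter fun U => U.card = j) =
          S.powersetCard j := by
        ext U
        simp only [mem_filter, mem_powerset, mem_powersetCard]
        exact ⟨fun h => ⟨h.1.1, h.2⟩, fun h => ⟨⟨h.1, h.2.le.trans hjt⟩, h.2⟩⟩
      rw [hset, zeroSumCount, ← sum_boole, mul_sum, sum_mul, mul_sum]
      refine sum_congr rfl fun U hU => ?_
      obtain ⟨hUS, rfl⟩ := mem_powersetCard.mp hU
      rw [sum_const, card_filter_powersetCard_subset U S t hUS hjt, nsmul_eq_mul]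
      split_ifs <;> ring
    · intro U hU
      simpa [Nat.lt_succ_iff] using (mem_filter.mp hU).2
  · intro T U
    simp only [mem_powersetCard, mem_powerset, mem_filter]
    refine ⟨fun h => ⟨⟨h.1, h.2⟩, h.2.trans h.1.1, ?_⟩, fun h => h.1⟩
    rw [← h.1.2]
    exact card_le_card h.2

theorem two_pow_mul_sum_dualWeight_pow (S : Finset ι) (f : ι → F) (h : ℕ) :
    2 ^ h * ∑ a : F, (dualWeight S f a : ℚ) ^ h =
      Fintype.card F * ∑ j ∈ range (min S.card h + 1), (-1) ^ j * (zeroSumCount S f j : ℚ) *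
        ∑ t ∈ Icc j h, (t.factorial : ℚ) * stirling h t * 2 ^ (h - t) *
          (binom (S.card - j) ((S.card : ℤ) - t) : ℚ) := by
  simp_rw [pow_eq_sum_stirling]
  rw [sum_comm, mul_sum]
  simp_rw [← mul_sum (s := (univ : Finset F))]
  have hstep : ∀ t ∈ range (h + 1),
      (2 : ℚ) ^ h * ((t.factorial : ℚ) * stirling h t *
        ∑ a : F, ((dualWeight S f a).choose t : ℚ)) =
      ∑ j ∈ range (t + 1), Fintype.card F * ((-1) ^ j * (zeroSumCount S f j : ℚ) *
        ((t.factorial : ℚ) * stirling h t * 2 ^ (h - t) *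
          (binom (S.card - j) ((S.card : ℤ) - t) : ℚ))) := by
    intro t ht
    have hth : t ≤ h := by simpa [Nat.lt_succ_iff] using ht
    have key : (2 : ℚ) ^ t * ∑ a : F, ((dualWeight S f a).choose t : ℚ) =
      Fintype.card F * ∑ j ∈ range (t + 1),
        (-1) ^ j * (zeroSumCount S f j : ℚ) * ((S.card - j).choose (t - j) : ℚ) := by
      exact_mod_cast sum_choose_dualWeight S f t
    rw [show (2 : ℚ) ^ h = 2 ^ (h - t) * 2 ^ t by rw [← pow_add, Nat.sub_add_cancel hth],
      mul_assoc, mul_left_comm ((2 : ℚ) ^ t), key, mul_sum, mul_sum, mul_sum]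
    refine sum_congr rfl fun j hj => ?_
    have hjt : j ≤ t := by simpa [Nat.lt_succ_iff] using hj
    rcases le_or_gt j S.card with hjS | hjS
    · rw [binom_sub hjt hjS]
      ring
    -- Here `S.card - j` is truncated, but no `j`-subset exists.
    · rw [zeroSumCount_eq_zero f hjS]
      simp
  rw [sum_congr rfl hstep, sum_comm' (t' := range (h + 1)) (s' := fun j => Icc j h)]
  · simp_rw [mul_sum]
    symm
    refine sum_subset (range_subset_range.mpr (by omega)) fun j hj hj' => ?_
    simp only [mem_range] at hj hj'
    rw [zeroSumCount_eq_zero f (by omega)]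
    simp
  · intro t j
    simp only [mem_range, mem_Icc]
    omega

theorem moment_recursion (S : Finset ι) (f : ι → F) {c M : ℤ} (hc : c ≠ 0)
    (hS : (S.card : ℤ) = c * M)
    (hK : ∀ b : Fˣ, ∑ i ∈ S, canonicalChar ((b : F) * f i) = c * kloosterman (b ^ 2))
    {h : ℕ} (hh : 1 ≤ h) :
    (moment F h : ℚ) =
      ∑ l ∈ range h, (-1 : ℚ) ^ (h + l + 1) * (h.choose l : ℚ) * (M : ℚ) ^ (h - l) *
        (moment F l : ℚ) +
      Fintype.card F * (c : ℚ) ^ (-(h : ℤ)) * ∑ j ∈ range (min S.card h + 1),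
        (-1 : ℚ) ^ (h + j) * (zeroSumCount S f j : ℚ) *
          ∑ t ∈ Icc j h, (t.factorial : ℚ) * stirling h t * 2 ^ (h - t) *
            (binom (S.card - j) ((S.card : ℤ) - t) : ℚ) := by
  have hc' : (c : ℚ) ≠ 0 := by exact_mod_cast hc
  have h0 : dualWeight S f 0 = 0 := by simp [dualWeight, tr_zero]
  have hb : ∀ b : Fˣ, (2 : ℚ) * dualWeight S f b = c * (M - kloosterman (b ^ 2)) := by
    intro b
    have := two_mul_dualWeight S f (b : F)
    rw [hK, hS, ← mul_sub] at this
    exact_mod_cast this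
  have hsum : 2 ^ h * ∑ a : F, (dualWeight S f a : ℚ) ^ h =
      c ^ h * ∑ l ∈ range (h + 1),
        (-1 : ℚ) ^ l * (h.choose l : ℚ) * (M : ℚ) ^ (h - l) * (moment F l : ℚ) := by
    have hu : ∑ a : F, (dualWeight S f a : ℚ) ^ h =
        ∑ b : Fˣ, (dualWeight S f (b : F) : ℚ) ^ h := by
      -- The element 0 gives weight 0, and `0 ^ h = 0` because `h ≥ 1`.
      rw [← sum_erase univ (a := (0 : F)) (by rw [h0, Nat.cast_zero, zero_pow (by omega)])]
      refine (sum_bij (fun (b : Fˣ) _ => (b : F)) ?_ (fun a _ b _ hab => Units.ext hab) ?_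
        fun _ _ => rfl).symm
      · intro b _
        simp
      · intro a ha
        exact ⟨Units.mk0 a (ne_of_mem_erase ha), mem_univ _, rfl⟩
    rw [hu, mul_sum]
    simp_rw [← mul_pow, hb, mul_pow, ← mul_sum]
    congr 1
    have : ∀ b : Fˣ, ((M : ℚ) - kloosterman (b ^ 2)) ^ h = ∑ l ∈ range (h + 1),
        (-1 : ℚ) ^ l * (h.choose l : ℚ) * (M : ℚ) ^ (h - l) * (kloosterman (b ^ 2) : ℚ) ^ l := by
      intro b
      rw [sub_eq_neg_add, add_pow]
      refine sum_congr rfl fun l _ => ?_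
      rw [neg_pow]
      ring
    simp_rw [this]
    rw [sum_comm]
    refine sum_congr rfl fun l _ => ?_
    rw [← mul_sum, ← sum_kloosterman_sq_pow]
    push_cast
    rfl
  -- The term `l = h` carries the moment to be solved for.
  rw [two_pow_mul_sum_dualWeight_pow, sum_range_succ _ h] at hsum
  have hsq : ((-1 : ℚ) ^ h) * (-1) ^ h = 1 := by rw [← mul_pow]; norm_num
  have e1 : ∑ l ∈ range h, (-1 : ℚ) ^ (h + l + 1) * (h.choose l : ℚ) * (M : ℚ) ^ (h - l) *
      (moment F l : ℚ) = -(-1) ^ h * ∑ l ∈ range h,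
        (-1 : ℚ) ^ l * (h.choose l : ℚ) * (M : ℚ) ^ (h - l) * (moment F l : ℚ) := by
    rw [mul_sum]
    exact sum_congr rfl fun l _ => by ring
  have e2 : ∑ j ∈ range (min S.card h + 1), (-1 : ℚ) ^ (h + j) * (zeroSumCount S f j : ℚ) *
      ∑ t ∈ Icc j h, (t.factorial : ℚ) * stirling h t * 2 ^ (h - t) *
        (binom (S.card - j) ((S.card : ℤ) - t) : ℚ) =
      (-1) ^ h * ∑ j ∈ range (min S.card h + 1), (-1) ^ j * (zeroSumCount S f j : ℚ) *
        ∑ t ∈ Icc j h, (t.factorial : ℚ) * stirling h t * 2 ^ (h - t) *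
          (binom (S.card - j) ((S.card : ℤ) - t) : ℚ) := by
    rw [mul_sum]
    exact sum_congr rfl fun l _ => by ring
  rw [e1, e2, show ∀ x y : ℚ, Fintype.card F * x * ((-1) ^ h * y) =
    x * (-1) ^ h * (Fintype.card F * y) from fun x y => by ring, hsum, zpow_neg, zpow_natCast]
  have hch : (c : ℚ) ^ h ≠ 0 := pow_ne_zero _ hc'
  field_simp
  simp only [Nat.sub_self, pow_zero, Nat.choose_self, Nat.cast_one]
  linear_combination (-(moment F h : ℚ)) * hsq

end PowerMoments

/-! ### Weight distributions as counts of zero-sum subsets. -/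

section Weights

variable {F : Type*} [Field F] [Fintype F] [Algebra (ZMod 2) F] [DecidableEq F]

/-- Whether a subset has zero sum depends only on how many elements it takes from each fibre of `f`;
given these numbers, the choices in the fibres are independent. -/
theorem zeroSumCount_eq_sum_prod_choose {ι : Type*} [DecidableEq ι] (S : Finset ι) (f : ι → F)
    (j : ℕ) :
    zeroSumCount S f j =
      ∑ ν ∈ ((univ : Finset F).piAntidiag j).filter (fun ν => ∑ β, (ν β : F) * β = 0),
        ∏ β, (S.filter fun i => f i = β).card.choose (ν β) := by
  have hsum : ∀ T : Finset ι, ∑ i ∈ T, f i = ∑ β, ((T.filter fun i => f i = β).card : F) * β := by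
    intro T
    rw [← sum_fiberwise T f]
    refine sum_congr rfl fun β _ => ?_
    rw [← nsmul_eq_mul, ← sum_const]
    exact sum_congr rfl fun i hi => (mem_filter.mp hi).2
  have hcard : ∀ T : Finset ι, T.card = ∑ β, (T.filter fun i => f i = β).card := fun T =>
    card_eq_sum_card_fiberwise fun _ _ => mem_coe.mpr (mem_univ _)
  rw [zeroSumCount, card_eq_sum_card_fiberwise
    (f := fun (T : Finset ι) (β : F) => (T.filter fun i => f i = β).card)
    (t := ((univ : Finset F).piAntidiag j).filter (fun ν => ∑ β, (ν β : F) * β = 0))]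
  · refine sum_congr rfl fun ν hν => ?_
    obtain ⟨hν1, hν2⟩ := mem_filter.mp hν
    have hν1 : ∑ β, ν β = j := (mem_piAntidiag.mp hν1).1
    simp_rw [← card_powersetCard]
    rw [← Fintype.card_piFinset]
    have hfil : ∀ p ∈ Fintype.piFinset fun β => (S.filter fun i => f i = β).powersetCard (ν β),
        ∀ β, ((univ.biUnion p).filter fun i => f i = β) = p β := by
      intro p hp β
      ext i
      have hp' : ∀ γ, i ∈ p γ → f i = γ := fun γ hi =>
        (mem_filter.mp ((mem_powersetCard.mp (Fintype.mem_piFinset.mp hp γ)).1 hi)).2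
      simp only [mem_filter, mem_biUnion, mem_univ, true_and]
      constructor
      · rintro ⟨⟨γ, hγ⟩, rfl⟩
        rwa [hp' γ hγ]
      · exact fun hi => ⟨⟨β, hi⟩, hp' β hi⟩
    refine card_nbij' (fun T β => T.filter fun i => f i = β) (fun p => univ.biUnion p) ?_ ?_ ?_ ?_
    · intro T hT
      simp only [coe_filter, mem_filter, mem_powersetCard, Set.mem_ofPred_eq] at hT
      rw [mem_coe, Fintype.mem_piFinset]
      exact fun β => mem_powersetCard.mpr
        ⟨filter_subset_filter _ hT.1.1.1, congrFun hT.2 β⟩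
    · intro p hp
      rw [mem_coe] at hp
      have hpc : ∀ β, (p β).card = ν β := fun β =>
        (mem_powersetCard.mp (Fintype.mem_piFinset.mp hp β)).2
      simp only [coe_filter, mem_filter, mem_powersetCard, Set.mem_ofPred_eq]
      refine ⟨⟨⟨?_, ?_⟩, ?_⟩, ?_⟩
      · refine biUnion_subset.mpr fun β _ => ?_
        exact (mem_powersetCard.mp (Fintype.mem_piFinset.mp hp β)).1.trans (filter_subset _ _)
      · rw [hcard]
        simp_rw [hfil p hp, hpc, hν1]
      · rw [hsum]
        simp_rw [hfil p hp, hpc, hν2]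
      · funext β
        rw [hfil p hp, hpc]
    · intro T _
      ext i
      simp
    · intro p hp
      funext β
      exact hfil p hp β
  · intro T hT
    obtain ⟨hT1, hT2⟩ := mem_filter.mp (mem_coe.mp hT)
    rw [mem_coe, mem_filter, mem_piAntidiag]
    exact ⟨⟨by rw [← hcard, (mem_powersetCard.mp hT1).2], fun _ _ => mem_univ _⟩,
      by rw [← hsum, hT2]⟩

theorem weightCount_eq_zeroSumCount {m : Type*} [Fintype m] [DecidableEq m]
    (S : Finset (Matrix m m F)) (j : ℕ) :
    weightCount S j = zeroSumCount S Matrix.trace j := by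
  rw [weightCount, zeroSumCount, ← Set.ncard_coe_finset]
  have hval : ∀ x : ZMod 2, x ≠ 0 → x = 1 := by decide
  have hcode : ∀ u : S → ZMod 2, u ∈ code S ↔
      ∑ g ∈ (univ.filter fun g => u g ≠ 0).map (Function.Embedding.subtype _),
        Matrix.trace g = 0 := by
    intro u
    change ∑ g : S, algebraMap (ZMod 2) F (u g) * Matrix.trace g.val = 0 ↔ _
    rw [sum_map, sum_filter]
    refine Eq.congr_left (sum_congr rfl fun g _ => ?_)
    split_ifs with hg
    · simp [hval _ hg]
    · simp [not_not.mp hg]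
  refine Set.ncard_congr
    (fun u _ => (univ.filter fun g => u g ≠ 0).map (Function.Embedding.subtype _)) ?_ ?_ ?_
  · rintro u ⟨hu, hj⟩
    rw [mem_coe, mem_filter, mem_powersetCard]
    refine ⟨⟨?_, by rw [card_map]; exact hj⟩, (hcode u).mp hu⟩
    intro g hg
    obtain ⟨g', -, rfl⟩ := mem_map.mp hg
    exact g'.2
  · intro u v _ _ huv
    have huv := map_injective _ huv
    funext g
    have hg : u g ≠ 0 ↔ v g ≠ 0 := by simpa using Finset.ext_iff.mp huv g
    by_cases h : u g = 0
    · rw [h, not_not.mp (mt hg.mpr (not_not.mpr h))]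
    · rw [hval _ h, hval _ (hg.mp h)]
  · intro T hT
    obtain ⟨h1, h2⟩ := mem_filter.mp (mem_coe.mp hT)
    obtain ⟨hTS, hTj⟩ := mem_powersetCard.mp h1
    have hT' : (univ.filter fun g : S => (if g.val ∈ T then 1 else 0 : ZMod 2) ≠ 0).map
        (Function.Embedding.subtype _) = T := by
      ext g
      simp only [mem_map, mem_filter, mem_univ, true_and, ne_eq, ite_eq_right_iff, one_ne_zero,
        imp_false, not_not, Function.Embedding.subtype_apply, Subtype.exists, exists_and_left,
        exists_prop, exists_eq_right_right]
      exact ⟨fun h => h.1, fun h => ⟨h, hTS h⟩⟩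
    refine ⟨fun g => if g.val ∈ T then 1 else 0, ⟨?_, ?_⟩, hT'⟩
    · rw [hcode, hT', h2]
    · rw [← hTj]
      conv_rhs => rw [← hT', card_map]
      rfl

end Weights

open Matrix

/-! ### Counting `SL(2, q)` by trace. -/

section SpecialLinear

variable {F : Type*} [Field F] [Fintype F] [DecidableEq F]

variable (F) in
/-- The `2 × 2` matrices of determinant one. -/
def detOne : Finset (Matrix (Fin 2) (Fin 2) F) := univ.filter fun A => A.det = 1

theorem mem_detOne {A : Matrix (Fin 2) (Fin 2) F} : A ∈ detOne F ↔ A.det = 1 := by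
  simp [detOne]

theorem mul_mem_detOne {A B : Matrix (Fin 2) (Fin 2) F} (hA : A ∈ detOne F) (hB : B ∈ detOne F) :
    A * B ∈ detOne F := by
  rw [mem_detOne] at *
  rw [det_mul, hA, hB, one_mul]

theorem adjugate_mem_detOne {A : Matrix (Fin 2) (Fin 2) F} (hA : A ∈ detOne F) :
    A.adjugate ∈ detOne F := by
  rw [mem_detOne] at *
  rw [det_adjugate, hA, one_pow]

theorem card_mul_eq (m : F) :
    (univ.filter fun p : F × F => p.1 * p.2 = m).card =
      Fintype.card F - 1 + if m = 0 then Fintype.card F else 0 := by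
  have h : ∀ b : F, (univ.filter fun c : F => b * c = m).card =
      if b = 0 then (if m = 0 then Fintype.card F else 0) else 1 := by
    intro b
    split_ifs with hb hm
    · simp [hb, hm]
    · simp [hb, Ne.symm hm]
    · rw [card_eq_one]
      refine ⟨b⁻¹ * m, ?_⟩
      ext c
      simp only [mem_filter, mem_univ, true_and, mem_singleton]
      rw [eq_inv_mul_iff_mul_eq₀ hb]
  have h2 : (univ.filter fun p : F × F => p.1 * p.2 = m).card =
      ∑ b : F, (univ.filter fun c : F => b * c = m).card := by
    simp only [card_filter, Fintype.sum_prod_type]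
  rw [h2, ← add_sum_erase univ _ (mem_univ (0 : F)), h, if_pos rfl, add_comm]
  congr 1
  rw [sum_congr rfl fun b hb => (h b).trans (if_neg (ne_of_mem_erase hb)), sum_const,
    card_erase_of_mem (mem_univ _), card_univ, smul_eq_mul, mul_one]

variable [Algebra (ZMod 2) F]

/-- Once the entry `a` at `(0, 0)` is fixed, the off-diagonal entries satisfy `b * c = a ^ 2 + β a +
1`: this has `q - 1` solutions, and `q` more when `a` is a root. -/
theorem card_detOne_trace (β : F) :
    ((detOne F).filter fun A => A.trace = β).card =
      Fintype.card F * (Fintype.card F - 1) + Fintype.card F * (quadRoots β).card := by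
  have : CharP F 2 := charP_two
  have h : ∀ a : F, (((detOne F).filter fun A => A.trace = β).filter fun A => A 0 0 = a).card =
      Fintype.card F - 1 + if a ^ 2 + β * a + 1 = 0 then Fintype.card F else 0 := by
    intro a
    rw [← card_mul_eq]
    refine card_nbij' (fun A => (A 0 1, A 1 0)) (fun p => !![a, p.1; p.2, a + β]) ?_ ?_ ?_ ?_
    · intro A hA
      simp only [coe_filter, mem_filter, mem_detOne, Set.mem_ofPred_eq, det_fin_two,
        trace_fin_two, mem_univ, true_and] at hA ⊢
      obtain ⟨⟨h1, h2⟩, h3⟩ := hA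
      rw [← h2, ← h3]
      linear_combination (-1 : F) * h1 - A 0 0 ^ 2 * CharTwo.two_eq_zero (R := F) - CharTwo.two_eq_zero (R := F)
    · rintro ⟨b, c⟩ hp
      simp only [coe_filter, mem_filter, mem_detOne, Set.mem_ofPred_eq, det_fin_two,
        trace_fin_two, mem_univ, true_and] at hp ⊢
      refine ⟨⟨?_, ?_⟩, rfl⟩
      · simp only [of_apply, cons_val', cons_val_zero, cons_val_one, cons_val_fin_one]
        linear_combination (-1 : F) * hp - CharTwo.two_eq_zero (R := F)
      · simp only [of_apply, cons_val', cons_val_zero, cons_val_one, cons_val_fin_one]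
        linear_combination a * CharTwo.two_eq_zero (R := F)
    · intro A hA
      simp only [coe_filter, mem_filter, Set.mem_ofPred_eq, trace_fin_two] at hA
      obtain ⟨⟨-, h2⟩, h3⟩ := hA
      ext i j
      fin_cases i <;> fin_cases j
      · simp [h3]
      · simp
      · simp
      · simp only [Fin.mk_one, of_apply, cons_val', cons_val_one, cons_val_fin_one]
        rw [← h2, ← h3]
        linear_combination A 0 0 * CharTwo.two_eq_zero (R := F)
    · rintro ⟨b, c⟩ _
      simp
  rw [card_eq_sum_card_fiberwise (f := fun A => A 0 0) (t := univ)
    fun _ _ => mem_coe.mpr (mem_univ _)]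
  simp_rw [h]
  rw [sum_add_distrib, sum_const, card_univ, ← sum_filter, sum_const, smul_eq_mul, smul_eq_mul,
    quadRoots, mul_comm (card _)]

theorem card_detOne : (detOne F).card = Fintype.card F * (Fintype.card F ^ 2 - 1) := by
  rw [card_eq_sum_card_fiberwise (f := trace) (t := univ) fun _ _ => mem_coe.mpr (mem_univ _)]
  simp_rw [card_detOne_trace]
  rw [sum_add_distrib, ← mul_sum, ← mul_sum, sum_card_quadRoots, sum_const, card_univ, smul_eq_mul]
  obtain ⟨p, hp⟩ : ∃ p, Fintype.card F = p + 1 :=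
    ⟨_, (Nat.succ_pred_eq_of_pos Fintype.card_pos).symm⟩
  rw [hp, show (p + 1) ^ 2 - 1 = p ^ 2 + 2 * p by
    rw [show (p + 1) ^ 2 = p ^ 2 + 2 * p + 1 by ring, Nat.add_sub_cancel], Nat.add_sub_cancel]
  ring

/-- On determinant one the adjugate is the inverse, so `(A, B) ↦ (B, A B⁻¹)` is a bijection. -/
theorem card_detOne_mul_adjugate (β : F) :
    ((detOne F ×ˢ detOne F).filter fun p => (p.1 * p.2.adjugate).trace = β).card =
      (detOne F).card * ((detOne F).filter fun A => A.trace = β).card := by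
  rw [← card_product]
  have h1 : ∀ B ∈ detOne F, B.adjugate * B = 1 := fun B hB => by
    rw [adjugate_mul, mem_detOne.mp hB, one_smul]
  have h2 : ∀ B ∈ detOne F, B * B.adjugate = 1 := fun B hB => by
    rw [mul_adjugate, mem_detOne.mp hB, one_smul]
  refine card_nbij' (fun p => (p.2, p.1 * p.2.adjugate)) (fun p => (p.2 * p.1, p.1)) ?_ ?_ ?_ ?_
  · rintro ⟨A, B⟩ h
    obtain ⟨h, ht⟩ := mem_filter.mp (mem_coe.mp h)
    obtain ⟨hA, hB⟩ := mem_product.mp h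
    exact mem_coe.mpr (mem_product.mpr
      ⟨hB, mem_filter.mpr ⟨mul_mem_detOne hA (adjugate_mem_detOne hB), ht⟩⟩)
  · rintro ⟨B, C⟩ h
    obtain ⟨hB, hC⟩ := mem_product.mp (mem_coe.mp h)
    obtain ⟨hC, ht⟩ := mem_filter.mp hC
    refine mem_coe.mpr (mem_filter.mpr ⟨mem_product.mpr ⟨mul_mem_detOne hC hB, hB⟩, ?_⟩)
    change (C * B * B.adjugate).trace = β
    rw [Matrix.mul_assoc, h2 B hB, Matrix.mul_one, ht]
  · rintro ⟨A, B⟩ h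
    obtain ⟨-, hB⟩ := mem_product.mp (mem_filter.mp (mem_coe.mp h)).1
    change (A * B.adjugate * B, B) = (A, B)
    rw [Matrix.mul_assoc, h1 B hB, Matrix.mul_one]
  · rintro ⟨B, C⟩ h
    obtain ⟨hB, -⟩ := mem_product.mp (mem_coe.mp h)
    change (B, C * B * B.adjugate) = (B, C)
    rw [Matrix.mul_assoc, h2 B hB, Matrix.mul_one]

end SpecialLinear

/-! ### The orthogonal group of the determinant form and the coset for `n = 2`. -/

section Quadric

/-- The coordinates of a `2 × 2` matrix in the order in which the determinant becomes the form
`x₁x₃ + x₂x₄` in characteristic two. -/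
def entryEquiv : Fin 2 ⊕ Fin 2 ≃ Fin 2 × Fin 2 where
  toFun := Sum.elim ![(0, 0), (0, 1)] ![(1, 1), (1, 0)]
  invFun p := (![![Sum.inl 0, Sum.inl 1], ![Sum.inr 1, Sum.inr 0]] : Fin 2 → Fin 2 → _) p.1 p.2
  left_inv := by decide
  right_inv := by decide

variable {F : Type*} [Field F]

/-- The matrix of the linear map `X ↦ A X B` on `2 × 2` matrices, with respect to the coordinates
`entryEquiv`. -/
def twoSided (A B : Matrix (Fin 2) (Fin 2) F) : Matrix (Fin 2 ⊕ Fin 2) (Fin 2 ⊕ Fin 2) F :=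
  (kroneckerMap (· * ·) A Bᵀ).submatrix entryEquiv entryEquiv

theorem twoSided_mul (A B A' B' : Matrix (Fin 2) (Fin 2) F) :
    twoSided A B * twoSided A' B' = twoSided (A * A') (B' * B) := by
  rw [twoSided, twoSided, twoSided, submatrix_mul_equiv, transpose_mul]
  exact congrArg (fun M => M.submatrix entryEquiv entryEquiv) (mul_kronecker_mul A A' Bᵀ B'ᵀ).symm

/-- The exchange of the first and third basis vectors. -/
def exchange : Fin 2 ⊕ Fin 2 ≃ Fin 2 ⊕ Fin 2 := Equiv.swap (Sum.inl 0) (Sum.inr 0)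

theorem sigma_eq_submatrix : sigma F 2 1 = (1 : Matrix _ _ F).submatrix exchange id := by
  ext i j
  rcases i with i | i <;> rcases j with j | j <;> fin_cases i <;> fin_cases j <;>
    simp [sigma, exchange, Equiv.swap_apply_def, Matrix.one_apply]

theorem sigma_mul (M : Matrix (Fin 2 ⊕ Fin 2) (Fin 2 ⊕ Fin 2) F) :
    sigma F 2 1 * M = M.submatrix exchange id := by
  rw [sigma_eq_submatrix]
  exact one_submatrix_mul exchange (Equiv.refl _) M

theorem mul_sigma (M : Matrix (Fin 2 ⊕ Fin 2) (Fin 2 ⊕ Fin 2) F) :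
    M * sigma F 2 1 = M.submatrix id exchange := by
  rw [sigma_eq_submatrix]
  exact mul_submatrix_one exchange id M

theorem sigma_mul_self : sigma F 2 1 * sigma F 2 1 = 1 := by
  rw [sigma_mul, sigma_eq_submatrix, submatrix_submatrix]
  have : exchange ∘ exchange = id := funext (by decide : ∀ i, exchange (exchange i) = i)
  rw [this]
  simp

/-- In characteristic two, swapping the diagonal entries is `X ↦ adj X`, and the adjugate reverses
products. -/
theorem twoSided_mul_sigma [CharP F 2] (A B : Matrix (Fin 2) (Fin 2) F) :
    twoSided A B * sigma F 2 1 = sigma F 2 1 * twoSided B.adjugate A.adjugate := by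
  rw [sigma_mul, mul_sigma, adjugate_fin_two, adjugate_fin_two]
  simp only [CharTwo.neg_eq]
  ext i j
  rcases i with i | i <;> rcases j with j | j <;> fin_cases i <;> fin_cases j <;>
    simp [exchange, Equiv.swap_apply_def, twoSided, entryEquiv, mul_comm]

/-- Since `adj X = tr(X) - X`, both sides equal `tr A * tr B + tr(A B)` in characteristic two. -/
theorem trace_twoSided_mul_sigma [CharP F 2] (A B : Matrix (Fin 2) (Fin 2) F) :
    (twoSided A B * sigma F 2 1).trace = (A * B.adjugate).trace := by
  rw [mul_sigma, adjugate_fin_two, trace_fin_two, Matrix.mul_apply, Matrix.mul_apply]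
  simp only [CharTwo.neg_eq]
  simp [Matrix.trace, exchange, Equiv.swap_apply_def, twoSided, entryEquiv]
  ring

/-- The products of entries determine the pair up to `(c A, c⁻¹ B)`; the determinants force `c ^ 2 =
1`, so `c = 1`. Concretely, multiplying the square of an entry by the other determinant writes it in
terms of these products. -/
theorem twoSided_inj [CharP F 2] {A B A' B' : Matrix (Fin 2) (Fin 2) F} (hA : A.det = 1)
    (hB : B.det = 1) (hA' : A'.det = 1) (hB' : B'.det = 1)
    (h : twoSided A B = twoSided A' B') : A = A' ∧ B = B' := by
  have key : ∀ i k l j, A i k * B l j = A' i k * B' l j := by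
    intro i k l j
    simpa [twoSided] using
      congrFun (congrFun h (entryEquiv.symm (i, j))) (entryEquiv.symm (k, l))
  have sq_inj : ∀ x y : F, x ^ 2 = y ^ 2 → x = y := fun x y hxy => frobenius_inj F 2 hxy
  rw [det_fin_two] at hA hB hA' hB'
  constructor
  · ext i k
    apply sq_inj
    calc A i k ^ 2 = (A i k * B 0 0) * (A i k * B 1 1) - (A i k * B 0 1) * (A i k * B 1 0) := by
          linear_combination -A i k ^ 2 * hB
      _ = A' i k ^ 2 := by
          rw [key, key, key, key]
          linear_combination A' i k ^ 2 * hB'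
  · ext l j
    apply sq_inj
    calc B l j ^ 2 = (A 0 0 * B l j) * (A 1 1 * B l j) - (A 0 1 * B l j) * (A 1 0 * B l j) := by
          linear_combination -B l j ^ 2 * hA
      _ = B' l j ^ 2 := by
          rw [key, key, key, key]
          linear_combination B' l j ^ 2 * hA'

/-- The square root `α` of the determinant normalises both factors to determinant one. -/
theorem fromBlocks_inv_transpose_eq_twoSided [CharP F 2] (A : GL (Fin 2) F) {α : F}
    (hα : α ^ 2 = A.val.det) :
    fromBlocks A.val 0 0 A⁻¹.val.transpose = twoSided !![α, 0; 0, α⁻¹] (α⁻¹ • A.valᵀ) := by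
  have hdet : A.val.det ≠ 0 := (isUnits_det_units A).ne_zero
  have h0 : α ≠ 0 := by
    rintro rfl
    exact hdet (by rw [← hα]; ring)
  rw [coe_units_inv, Matrix.inv_def, adjugate_fin_two, ← hα, Ring.inverse_eq_inv']
  ext i j
  rcases i with i | i <;> rcases j with j | j <;> fin_cases i <;> fin_cases j <;>
    simp [twoSided, entryEquiv, CharTwo.neg_eq, h0] <;> ring

theorem fromBlocks_one_eq_twoSided [CharP F 2] {B : Matrix (Fin 2) (Fin 2) F}
    (h0 : ∀ i, B i i = 0) (h1 : ∀ i j, B i j = -B j i) :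
    fromBlocks 1 B 0 1 = twoSided !![1, B 0 1; 0, 1] 1 := by
  have h2 : B 1 0 = B 0 1 := by rw [h1, CharTwo.neg_eq]
  ext i j
  rcases i with i | i <;> rcases j with j | j <;> fin_cases i <;> fin_cases j <;>
    simp [twoSided, entryEquiv, h0, h2]

variable [Fintype F] [DecidableEq F]

theorem exists_twoSided_of_mem_parabolic [CharP F 2]
    {w : Matrix (Fin 2 ⊕ Fin 2) (Fin 2 ⊕ Fin 2) F} (hw : w ∈ parabolic F 2) :
    ∃ A ∈ detOne F, ∃ B ∈ detOne F, w = twoSided A B := by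
  obtain ⟨A, B, h0, h1, rfl⟩ := hw
  obtain ⟨α, hα⟩ := (frobeniusEquiv F 2).surjective A.val.det
  replace hα : α ^ 2 = A.val.det := hα
  have hdet : A.val.det ≠ 0 := (isUnits_det_units A).ne_zero
  have hα0 : α ≠ 0 := by
    rintro rfl
    exact hdet (by rw [← hα]; ring)
  rw [fromBlocks_inv_transpose_eq_twoSided A hα, fromBlocks_one_eq_twoSided h0 h1, twoSided_mul]
  refine ⟨_, ?_, _, ?_, rfl⟩
  · rw [mem_detOne, det_mul]
    simp [det_fin_two_of, hα0]
  · rw [mem_detOne, det_mul, det_smul, det_transpose, ← hα]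
    simp [hα0]

theorem twoSided_one_mem_parabolic [CharP F 2] {B : Matrix (Fin 2) (Fin 2) F}
    (hB : B ∈ detOne F) : twoSided 1 B ∈ parabolic F 2 := by
  have hB' : IsUnit Bᵀ.det := by
    rw [det_transpose, mem_detOne.mp hB]
    exact isUnit_one
  refine ⟨Matrix.nonsingInvUnit Bᵀ hB', 0, by simp, by simp, ?_⟩
  have hval : (Matrix.nonsingInvUnit Bᵀ hB').val = Bᵀ := rfl
  rw [fromBlocks_inv_transpose_eq_twoSided _ (α := 1), fromBlocks_one, mul_one, hval]
  · simp [Matrix.one_fin_two]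
  · rw [hval, det_transpose, mem_detOne.mp hB, one_pow]

theorem dcOne_two [CharP F 2] :
    dcOne F 2 = (detOne F ×ˢ detOne F).image fun p => twoSided p.1 p.2 * sigma F 2 1 := by
  ext w
  simp only [dcOne, mem_filter, mem_univ, true_and, mem_image, mem_product, Prod.exists]
  constructor
  · rintro ⟨p, hp, p', hp', rfl⟩
    obtain ⟨A, hA, B, hB, rfl⟩ := exists_twoSided_of_mem_parabolic hp
    obtain ⟨A', hA', B', hB', rfl⟩ := exists_twoSided_of_mem_parabolic hp'
    -- Moving `σ` to the right past `twoSided A' B'` turns that factor into `twoSided (adj B') (adj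
    -- A')`.
    refine ⟨A * B'.adjugate, A'.adjugate * B,
      ⟨mul_mem_detOne hA (adjugate_mem_detOne hB'), mul_mem_detOne (adjugate_mem_detOne hA') hB⟩, ?_⟩
    rw [← twoSided_mul, Matrix.mul_assoc, twoSided_mul_sigma, Matrix.mul_assoc,
      adjugate_adjugate', adjugate_adjugate']
    simp
  · rintro ⟨A, B, ⟨hA, hB⟩, rfl⟩
    -- The parabolic contains every right multiplication, and `σ` converts the second one into left
    -- multiplication by `A`.
    refine ⟨twoSided 1 B, twoSided_one_mem_parabolic hB, twoSided 1 A.adjugate,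
      twoSided_one_mem_parabolic (adjugate_mem_detOne hA), ?_⟩
    have h := twoSided_mul_sigma A (1 : Matrix (Fin 2) (Fin 2) F)
    rw [adjugate_one] at h
    rw [Matrix.mul_assoc]
    change _ = _ * (sigma F 2 1 * _)
    rw [← h, ← Matrix.mul_assoc, twoSided_mul, one_mul, one_mul]

theorem injOn_twoSided_mul_sigma [CharP F 2] :
    Set.InjOn (fun p : Matrix (Fin 2) (Fin 2) F × Matrix (Fin 2) (Fin 2) F =>
      twoSided p.1 p.2 * sigma F 2 1) (detOne F ×ˢ detOne F : Finset _) := by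
  rintro ⟨A, B⟩ h ⟨A', B'⟩ h' heq
  obtain ⟨hA, hB⟩ := mem_product.mp (mem_coe.mp h)
  obtain ⟨hA', hB'⟩ := mem_product.mp (mem_coe.mp h')
  have heq' := congrArg (fun w => w * sigma F 2 1) heq
  simp only [Matrix.mul_assoc, sigma_mul_self, Matrix.mul_one] at heq'
  obtain ⟨h1, h2⟩ := twoSided_inj (mem_detOne.mp hA) (mem_detOne.mp hB) (mem_detOne.mp hA')
    (mem_detOne.mp hB') heq'
  exact Prod.ext h1 h2

variable [Algebra (ZMod 2) F]

theorem card_dcOne_two :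
    (dcOne F 2).card = Fintype.card F ^ 2 * (Fintype.card F ^ 2 - 1) ^ 2 := by
  have : CharP F 2 := charP_two
  rw [dcOne_two, card_image_of_injOn injOn_twoSided_mul_sigma, card_product, card_detOne]
  ring

theorem card_dcOne_two_trace (β : F) :
    ((dcOne F 2).filter fun w => w.trace = β).card =
      Fintype.card F ^ 2 * (Fintype.card F ^ 2 - 1) *
        (Fintype.card F - 1 + (quadRoots β).card) := by
  have : CharP F 2 := charP_two
  rw [dcOne_two, filter_image, card_image_of_injOn
    (injOn_twoSided_mul_sigma.mono (by exact_mod_cast filter_subset _ _))]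
  simp_rw [trace_twoSided_mul_sigma]
  rw [card_detOne_mul_adjugate, card_detOne, card_detOne_trace]
  ring

end Quadric

/-! ### The coset for `n = 1`. -/

section Torus

variable {F : Type*} [Field F]

/-- The matrix `diag(α, α⁻¹)`. -/
def torus (α : Fˣ) : Matrix (Fin 1 ⊕ Fin 1) (Fin 1 ⊕ Fin 1) F :=
  fromBlocks (diagonal fun _ => (α : F)) 0 0 (diagonal fun _ => (α : F)⁻¹)

theorem torus_mul (α β : Fˣ) : torus α * torus β = torus (α * β) := by
  simp [torus, mul_comm]

theorem torus_one : torus (1 : Fˣ) = 1 := by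
  simp [torus]

theorem torus_injective : Function.Injective (torus (F := F)) := by
  intro α β h
  have := congrFun (congrFun h (Sum.inl 0)) (Sum.inl 0)
  exact Units.ext (by simpa [torus] using this)

theorem trace_torus (α : Fˣ) : (torus α).trace = (α : F) + (α : F)⁻¹ := by
  simp [torus, Matrix.trace]

theorem parabolic_one : parabolic F 1 = Set.range (torus (F := F)) := by
  have hinv : ∀ A : GL (Fin 1) F, ∃ α : Fˣ, A.val = diagonal (fun _ => (α : F)) ∧
      A⁻¹.val = diagonal (fun _ => (α : F)⁻¹) := by
    intro A
    refine ⟨GeneralLinearGroup.det A, ?_, ?_⟩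
    · ext i j
      fin_cases i; fin_cases j
      simp
    · rw [coe_units_inv, Matrix.inv_def, Ring.inverse_eq_inv']
      ext i j
      fin_cases i; fin_cases j
      simp
  ext w
  constructor
  · rintro ⟨A, B, h0, -, rfl⟩
    obtain ⟨α, h1, h2⟩ := hinv A
    have hB : B = 0 := by
      ext i j
      rw [Subsingleton.elim i j, h0]
      rfl
    refine ⟨α, ?_⟩
    rw [h1, h2, hB, fromBlocks_one, mul_one, diagonal_transpose, torus]
  · rintro ⟨α, rfl⟩
    refine ⟨GeneralLinearGroup.mkOfDetNeZero (diagonal fun _ => (α : F)) (by simp), 0,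
      by simp, by simp, ?_⟩
    obtain ⟨β, h1, h2⟩ := hinv (GeneralLinearGroup.mkOfDetNeZero (diagonal fun _ => (α : F))
      (by simp))
    have : β = α := by
      have := congrFun (congrFun h1 0) 0
      exact Units.ext (by simpa [GeneralLinearGroup.mkOfDetNeZero] using this.symm)
    rw [h1, h2, this, fromBlocks_one, mul_one, diagonal_transpose, torus]

theorem sigma_zero_right (n : ℕ) : sigma F n 0 = 1 := by
  simp [sigma]

variable [Fintype F]

theorem coe_dcOne_one :
    (dcOne F 1 : Set (Matrix (Fin 1 ⊕ Fin 1) (Fin 1 ⊕ Fin 1) F)) = parabolic F 1 := by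
  ext w
  simp only [dcOne, coe_filter, mem_univ, true_and, Set.mem_ofPred_eq, Nat.sub_self,
    sigma_zero_right, mul_one, parabolic_one]
  constructor
  · rintro ⟨_, ⟨α, rfl⟩, _, ⟨β, rfl⟩, rfl⟩
    exact ⟨α * β, (torus_mul α β).symm⟩
  · rintro ⟨α, rfl⟩
    exact ⟨_, ⟨α, rfl⟩, _, ⟨1, rfl⟩, by rw [torus_one, mul_one]⟩

variable [DecidableEq F]

theorem dcOne_one : dcOne F 1 = univ.image (torus (F := F)) := by
  rw [← coe_inj, coe_dcOne_one, parabolic_one, coe_image, coe_univ, Set.image_univ]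

theorem card_dcOne_one : (dcOne F 1).card = Fintype.card F - 1 := by
  rw [dcOne_one, card_image_of_injective _ torus_injective, card_univ, Fintype.card_units]

theorem card_dcOne_one_trace [Algebra (ZMod 2) F] (β : F) :
    ((dcOne F 1).filter fun w => w.trace = β).card = (quadRoots β).card := by
  rw [dcOne_one, filter_image, card_image_of_injective _ torus_injective, ← card_units_add_inv]
  simp_rw [trace_torus]

end Torus

/-! ### Character sums and weight formulas for the two cosets. -/

section Codes

variable {F : Type*} [Field F] [Fintype F] [Algebra (ZMod 2) F] [DecidableEq F]

/-- The contribution of `d` is a multiple of a full sum of a nontrivial character, hence zero. -/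
theorem sum_canonicalChar_trace {m : Type*} [Fintype m] [DecidableEq m]
    (S : Finset (Matrix m m F)) {c d : ℕ}
    (hS : ∀ β, (S.filter fun w => w.trace = β).card = c * (d + (quadRoots β).card)) (b : Fˣ) :
    ∑ w ∈ S, canonicalChar ((b : F) * w.trace) = (c : ℤ) * kloosterman (b ^ 2) := by
  rw [← sum_fiberwise S Matrix.trace]
  have h : ∀ β : F, ∑ w ∈ S with w.trace = β, canonicalChar ((b : F) * w.trace) =
      c * d * canonicalChar (β * (b : F)) +
        c * ((quadRoots β).card * canonicalChar ((b : F) * β)) := by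
    intro β
    rw [sum_congr rfl fun w hw => by rw [(mem_filter.mp hw).2], sum_const, hS, nsmul_eq_mul,
      mul_comm β]
    push_cast
    ring
  simp_rw [h]
  rw [sum_add_distrib, ← mul_sum, ← mul_sum, sum_canonicalChar_mul, if_neg b.ne_zero, mul_zero,
    zero_add, sum_card_quadRoots_mul_canonicalChar]

theorem weightCount_dcOne_two {q : ℕ} (hq : Fintype.card F = q) (j : ℕ) :
    weightCount (dcOne F 2) j =
      ∑ ν ∈ ((univ : Finset F).piAntidiag j).filter (fun ν => ∑ β, (ν β : F) * β = 0),
        (q ^ 3 * (q ^ 2 - 1)).choose (ν 0) *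
        (∏ β ∈ trInv F 0, (q ^ 2 * (q - 1) * (q + 1) ^ 2).choose (ν β)) *
        (∏ β ∈ trInv F 1, (q ^ 2 * (q + 1) * (q - 1) ^ 2).choose (ν β)) := by
  rw [weightCount_eq_zeroSumCount, zeroSumCount_eq_sum_prod_choose]
  obtain ⟨p, rfl⟩ : ∃ p, q = p + 1 := by
    rw [← hq]
    exact ⟨_, (Nat.succ_pred_eq_of_pos Fintype.card_pos).symm⟩
  have hp : (p + 1) ^ 2 - 1 = p ^ 2 + 2 * p := by
    rw [show (p + 1) ^ 2 = p ^ 2 + 2 * p + 1 by ring, Nat.add_sub_cancel]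
  refine sum_congr rfl fun ν _ => ?_
  rw [prod_univ_eq_trInv]
  simp_rw [card_dcOne_two_trace, hq, hp, Nat.add_sub_cancel]
  congr 1
  · congr 1
    · rw [card_quadRoots_zero]
      congr 1
      ring
    · refine prod_congr rfl fun β hβ => ?_
      rw [card_quadRoots_of_mem_trInv_zero hβ]
      congr 1
      ring
  · refine prod_congr rfl fun β hβ => ?_
    rw [card_quadRoots_of_mem_trInv_one hβ]
    congr 1
    ring

theorem weightCount_dcOne_one (j : ℕ) :
    weightCount (dcOne F 1) j =
      ∑ ν ∈ ((insert 0 (trInv F 0)).piAntidiag j).filter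
          (fun ν => ∑ β ∈ trInv F 0, (ν β : F) * β = 0),
        Nat.choose 1 (ν 0) * ∏ β ∈ trInv F 0, Nat.choose 2 (ν β) := by
  have hsum : ∀ ν : F → ℕ, (∀ β, ν β ≠ 0 → β ∈ insert 0 (trInv F 0)) →
      ∑ β, (ν β : F) * β = ∑ β ∈ trInv F 0, (ν β : F) * β := by
    intro ν hν
    symm
    refine sum_subset (subset_univ _) fun β _ hβ => ?_
    by_cases h0 : β = 0
    · rw [h0, mul_zero]
    · by_cases h : ν β = 0
      · rw [h, Nat.cast_zero, zero_mul]
      · exact absurd (mem_of_mem_insert_of_ne (hν β h) h0) hβ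
  rw [weightCount_eq_zeroSumCount, zeroSumCount_eq_sum_prod_choose]
  simp_rw [card_dcOne_one_trace]
  symm
  have hterm : ∀ ν : F → ℕ, (∀ β, ν β ≠ 0 → β ∈ insert 0 (trInv F 0)) →
      Nat.choose 1 (ν 0) * ∏ β ∈ trInv F 0, Nat.choose 2 (ν β) =
        ∏ β, (quadRoots β).card.choose (ν β) := by
    intro ν hν
    have h2 : ∏ β ∈ trInv F 0, (quadRoots β).card.choose (ν β) =
        ∏ β ∈ trInv F 0, Nat.choose 2 (ν β) :=
      prod_congr rfl fun β hβ => by rw [card_quadRoots_of_mem_trInv_zero hβ]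
    rw [prod_univ_eq_trInv, card_quadRoots_zero, h2, prod_eq_one (s := trInv F 1), mul_one]
    intro β hβ
    have h : ν β = 0 := by
      by_contra h
      rcases mem_insert.mp (hν β h) with h0 | h0
      · exact zero_notMem_trInv 1 (h0 ▸ hβ)
      · exact disjoint_left.mp disjoint_trInv h0 hβ
    rw [h, Nat.choose_zero_right]
  rw [sum_congr rfl fun ν hν =>
    hterm ν (mem_piAntidiag.mp (mem_filter.mp hν).1).2]
  -- A family with `ν β ≠ 0` for some `β` in `trInv F 1` contributes a factor `Nat.choose 0 (ν β) =
  -- 0`.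
  refine sum_subset ?_ ?_
  · intro ν hν
    obtain ⟨h1, h2⟩ := mem_filter.mp hν
    obtain ⟨h3, h4⟩ := mem_piAntidiag.mp h1
    refine mem_filter.mpr ⟨mem_piAntidiag.mpr ⟨?_, fun _ _ => mem_univ _⟩, by rw [hsum ν h4, h2]⟩
    rw [← h3]
    symm
    refine sum_subset (subset_univ _) fun β _ hβ => ?_
    by_contra h
    exact hβ (h4 β h)
  · intro ν hν hν'
    obtain ⟨h1, h2⟩ := mem_filter.mp hν
    obtain ⟨h3, -⟩ := mem_piAntidiag.mp h1
    have hex : ∃ β, ν β ≠ 0 ∧ β ∉ insert 0 (trInv F 0) := by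
      by_contra! hall
      refine hν' (mem_filter.mpr ⟨mem_piAntidiag.mpr ⟨?_, hall⟩, by rw [← hsum ν hall, h2]⟩)
      rw [← h3]
      refine sum_subset (subset_univ _) fun β _ hβ => ?_
      by_contra h
      exact hβ (hall β h)
    obtain ⟨β, hβ, hβ'⟩ := hex
    refine prod_eq_zero (mem_univ β) ?_
    have h : β ∈ insert 0 (trInv F 0 ∪ trInv F 1) := by
      rw [insert_zero_trInv_union]
      exact mem_univ β
    have h : β ∈ trInv F 1 := by
      simp only [mem_insert, mem_union] at h hβ'
      tauto
    rw [card_quadRoots_of_mem_trInv_one h, Nat.choose_eq_zero_of_lt (Nat.pos_of_ne_zero hβ)]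

end Codes

end KloostermanCode

/-- In the weight formulas, `univ.piAntidiag j` is the set of all families of nonnegative integers
`ν_β`, for `β ∈ F`, of sum `j`; and `(insert 0 T).piAntidiag j` is the set of those families indexed
by `{0} ∪ T` (extended by zero), again of sum `j`. -/
theorem corollary2 {F : Type*} [Field F] [Fintype F] [DecidableEq F] [Algebra (ZMod 2) F]
    (q r : ℕ) (hr : 0 < r) (hqr : q = 2 ^ r) (hq : Fintype.card F = q) :
    -- part (a)
    ((dcOne F 2).card = q ^ 2 * (q ^ 2 - 1) ^ 2 ∧
      (∀ j ≤ q ^ 2 * (q ^ 2 - 1) ^ 2,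
        weightCount (dcOne F 2) j =
          ∑ ν ∈ ((univ : Finset F).piAntidiag j).filter (fun ν => ∑ β, (ν β : F) * β = 0),
            (q ^ 3 * (q ^ 2 - 1)).choose (ν 0) *
            (∏ β ∈ trInv F 0, (q ^ 2 * (q - 1) * (q + 1) ^ 2).choose (ν β)) *
            (∏ β ∈ trInv F 1, (q ^ 2 * (q + 1) * (q - 1) ^ 2).choose (ν β))) ∧
      (∀ h : ℕ, 1 ≤ h →
        (moment F h : ℚ) =
          ∑ l ∈ range h,
            (-1 : ℚ) ^ (h + l + 1) * (h.choose l : ℚ) * ((q : ℚ) ^ 2 - 1) ^ (h - l) *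
              (moment F l : ℚ) +
          (q : ℚ) ^ (1 - 2 * (h : ℤ)) * ((q : ℚ) ^ 2 - 1) ^ (-(h : ℤ)) *
            ∑ j ∈ range (min (q ^ 2 * (q ^ 2 - 1) ^ 2) h + 1),
              (-1 : ℚ) ^ (h + j) * (weightCount (dcOne F 2) j : ℚ) *
                ∑ t ∈ Icc j h,
                  (t.factorial : ℚ) * stirling h t * 2 ^ (h - t) *
                    (binom (q ^ 2 * (q ^ 2 - 1) ^ 2 - j)
                      (((q ^ 2 * (q ^ 2 - 1) ^ 2 : ℕ) : ℤ) - (t : ℤ)) : ℚ))) ∧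
    -- part (b)
    ((dcOne F 1 : Set (Matrix (Fin 1 ⊕ Fin 1) (Fin 1 ⊕ Fin 1) F)) = parabolic F 1 ∧
      (dcOne F 1).card = q - 1 ∧
      (8 ≤ q →
        (∀ j ≤ q - 1,
          weightCount (dcOne F 1) j =
            ∑ ν ∈ ((insert 0 (trInv F 0)).piAntidiag j).filter
                (fun ν => ∑ β ∈ trInv F 0, (ν β : F) * β = 0),
              Nat.choose 1 (ν 0) * ∏ β ∈ trInv F 0, Nat.choose 2 (ν β)) ∧
        (∀ h : ℕ, 1 ≤ h →
          (moment F h : ℚ) =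
            ∑ l ∈ range h,
              (-1 : ℚ) ^ (h + l + 1) * (h.choose l : ℚ) * ((q : ℚ) - 1) ^ (h - l) *
                (moment F l : ℚ) +
            (q : ℚ) *
              ∑ j ∈ range (min (q - 1) h + 1),
                (-1 : ℚ) ^ (h + j) * (weightCount (dcOne F 1) j : ℚ) *
                  ∑ t ∈ Icc j h,
                    (t.factorial : ℚ) * stirling h t * 2 ^ (h - t) *
                      (binom (q - 1 - j) (((q - 1 : ℕ) : ℤ) - (t : ℤ)) : ℚ)))) := by
  have hq1 : 1 < q := hq ▸ Fintype.one_lt_card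
  have hsq : 1 ≤ q ^ 2 := Nat.one_le_pow _ _ (by omega)
  have hsq' : q ^ 2 - 1 ≠ 0 := by
    have : 1 < q ^ 2 := Nat.one_lt_pow (by norm_num) hq1
    omega
  have hN2 : (dcOne F 2).card = q ^ 2 * (q ^ 2 - 1) ^ 2 := by rw [card_dcOne_two, hq]
  have hN1 : (dcOne F 1).card = q - 1 := by rw [card_dcOne_one, hq]
  refine ⟨⟨hN2, fun j _ => weightCount_dcOne_two hq j, fun h hh => ?_⟩,
    coe_dcOne_one, hN1, fun _ => ⟨fun j _ => weightCount_dcOne_one j, fun h hh => ?_⟩⟩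
  · have hq0 : (q : ℚ) ≠ 0 := by exact_mod_cast (by omega : q ≠ 0)
    have key := moment_recursion (dcOne F 2) Matrix.trace
      (c := ((q ^ 2 * (q ^ 2 - 1) : ℕ) : ℤ)) (M := ((q ^ 2 - 1 : ℕ) : ℤ))
      (by exact_mod_cast mul_ne_zero (by omega) hsq')
      (by rw [hN2]; push_cast; ring)
      (sum_canonicalChar_trace _ fun β => by rw [card_dcOne_two_trace, hq]) hh
    simp_rw [hN2, ← weightCount_eq_zeroSumCount] at key
    rw [key, hq]
    push_cast [Nat.cast_sub hsq]
    congr 2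
    -- The factor `q ^ (1 - 2h)` is the field size `q` times the part `q ^ (-2h)` of `c ^ (-h)`.
    rw [mul_zpow, ← mul_assoc, sub_eq_add_neg (1 : ℤ), zpow_add₀ hq0, zpow_one, ← zpow_natCast,
      ← zpow_mul]
    congr 3
    push_cast
    ring
  · have key := moment_recursion (dcOne F 1) Matrix.trace (c := ((1 : ℕ) : ℤ))
      (M := ((q - 1 : ℕ) : ℤ)) (by norm_num) (by rw [hN1]; push_cast; ring)
      (sum_canonicalChar_trace (d := 0) _ fun β => by
        rw [card_dcOne_one_trace, zero_add, one_mul]) hh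
    simp_rw [hN1, ← weightCount_eq_zeroSumCount] at key
    rw [key, hq]
    push_cast [Nat.cast_sub hq1.le]
    rw [one_zpow, mul_one]
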